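/- Let $n\ge 3$ and $d\ge 2$. Let $\mathcal P_n$ be the class of (arc length parametrisations of) closed equilateral polygons in $\mathbb R^d$ of total length $1$ with $n$ segments; $p\in\mathcal P_n$ has consecutive vertices $x_1,\dots,x_n$ (indices modulo $n$) with $|x_{i+1}-x_i|=\frac1n$. The discrete curvature at the vertex $x_i$ is $$\kappa_d(x_{i-1},x_i,x_{i+1})=\frac{2\tan(\phi_i/2)}{\frac12\left(|x_{i-1}-x_i|+|x_{i+1}-x_i|\right)}\in[0,\infty],$$ where $\phi_i=\measuredangle(x_i-x_{i-1},x_{i+1}-x_i)\in[0,\pi]$ is the exterior angle at $x_i$ and $\tan\frac{\pi}{2}=\infty$. Put $\operatorname{minRad}(p)=\min_i \kappa_d(x_{i-1},x_i,x_{i+1})^{-1}$. Let $\operatorname{dcsd}(p)$ be the minimum of $|y-x|$ over all pairs of distinct points $x=p(t)$, $y=p(s)$ of the polygon such that $s$ locally extremizes $u\mapsto|p(t)-p(u)|^2$ and $t$ locally extremizes $v\mapsto|p(v)-p(s)|^2$. The discrete thickness of $p$ is $\Delta_n[p]=\min\{\operatorname{minRad}(p),\tfrac12\operatorname{dcsd}(p)\}$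 if all vertices of $p$ are distinct, and $\Delta_n[p]=0$ if two vertices coincide; throughout, $0^{-1}=\infty$ and $\infty^{-1}=0$. Let $g_n\in\mathcal P_n$ be the regular $n$-gon of length $1$. Then $\Delta_n[g_n]^{-1}=2n\tan(\pi/n)$, and for every $p\in\mathcal P_n$ $$\Delta_n[g_n]^{-1}\le\Delta_n[p]^{-1},$$ with equality if and only if $p$ is a regular $n$-gon (planar and convex, i.e. its consecutive vertices are equally spaced on a circle in a two-dimensional affine plane, going around the circle once). -/

import Mathlib

open scoped ENNReal

noncomputable section

/-- The discrete curvature `κ_d(x, y, z) = 2 tan(φ/2) / ((|x - y| + |z - y|)/2)` at the vertex `y`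
with neighbours `x` and `z`, where `φ = ∡(y - x, z - y) ∈ [0, π]` is the exterior angle at `y`.
It takes values in `[0, ∞]`; for `φ = π`, where `tan (φ/2) = ∞`, it is `∞`. -/
def discreteCurvature {d : ℕ} (x y z : EuclideanSpace ℝ (Fin d)) : ℝ≥0∞ :=
  if InnerProductGeometry.angle (y - x) (z - y) = Real.pi then ⊤
  else ENNReal.ofReal
    (2 * Real.tan (InnerProductGeometry.angle (y - x) (z - y) / 2) /
      ((‖x - y‖ + ‖z - y‖) / 2))

/-- Closed equilateral polygons of length `1` with `n` segments in `ℝ^d`, given by the cyclic family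
of their vertices. The arc length parametrisation is `EquilateralPolygon.curve`. -/
structure EquilateralPolygon (n d : ℕ) where
  /-- The vertices, with indices read modulo `n`. -/
  vertex : ZMod n → EuclideanSpace ℝ (Fin d)
  /-- Every segment has length `1 / n`. -/
  dist_vertex : ∀ i, dist (vertex i) (vertex (i + 1)) = 1 / (n : ℝ)

namespace EquilateralPolygon

variable {n d : ℕ}

/-- The arc length parametrisation of the polygon, as a `1`-periodic function on the real line:
it is affine on every interval `[k / n, (k + 1) / n]` and `curve (k / n)` is the `k`-th vertex. -/
def curve (p : EquilateralPolygon n d) (t : ℝ) : EuclideanSpace ℝ (Fin d) :=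
  p.vertex ((⌊(n : ℝ) * t⌋ : ℤ) : ZMod n) +
    Int.fract ((n : ℝ) * t) •
      (p.vertex ((⌊(n : ℝ) * t⌋ : ℤ) + 1 : ZMod n) - p.vertex ((⌊(n : ℝ) * t⌋ : ℤ) : ZMod n))

/-- The minimal radius of curvature, the minimum over all vertices of `1 / κ_d`
(where `1 / 0 = ∞` and `1 / ∞ = 0`). -/
def minRad (p : EquilateralPolygon n d) : ℝ≥0∞ :=
  ⨅ i : ZMod n, (discreteCurvature (p.vertex (i - 1)) (p.vertex i) (p.vertex (i + 1)))⁻¹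

/-- The doubly critical pairs: pairs of distinct points `x = p(t)`, `y = p(s)` of the polygon such
that `s` locally extremizes `u ↦ |p(t) - p(u)|²` and `t` locally extremizes
`v ↦ |p(v) - p(s)|²`. -/
def dcrit (p : EquilateralPolygon n d) :
    Set (EuclideanSpace ℝ (Fin d) × EuclideanSpace ℝ (Fin d)) :=
  {q | q.1 ≠ q.2 ∧ ∃ t s : ℝ, q.1 = p.curve t ∧ q.2 = p.curve s ∧
    IsLocalExtr (fun u => ‖p.curve t - p.curve u‖ ^ 2) s ∧
    IsLocalExtr (fun v => ‖p.curve v - p.curve s‖ ^ 2) t}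

/-- The doubly critical self distance, the least distance of a doubly critical pair. -/
def dcsd (p : EquilateralPolygon n d) : ℝ≥0∞ :=
  ⨅ q ∈ p.dcrit, edist q.2 q.1

open Classical in
/-- The discrete thickness `Δ_n`: the minimum of the minimal radius of curvature and half of the
doubly critical self distance if all vertices are distinct, and `0` otherwise. -/
def thickness (p : EquilateralPolygon n d) : ℝ≥0∞ :=
  if Function.Injective p.vertex then min p.minRad (p.dcsd / 2) else 0

end EquilateralPolygon

/-- The `n` points at the angles `2 π i / n` on the circle with centre `c` and radius
`1 / (2 n sin (π / n))` in the plane through `c` that is spanned by `u` and `v`. If `u` and `v` are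
orthonormal, these are the consecutive vertices of a regular `n`-gon of length `1`. -/
def circleVertex (n : ℕ) {d : ℕ} (c u v : EuclideanSpace ℝ (Fin d)) (i : ZMod n) :
    EuclideanSpace ℝ (Fin d) :=
  c + (1 / (2 * (n : ℝ) * Real.sin (Real.pi / n))) •
    (Real.cos (2 * Real.pi * (i.val : ℝ) / n) • u + Real.sin (2 * Real.pi * (i.val : ℝ) / n) • v)

/-- A polygon of length `1` is a regular `n`-gon if its consecutive vertices are equally spaced on a
circle in some two-dimensional affine plane, going around the circle exactly once. -/
def EquilateralPolygon.IsRegular {n d : ℕ} (p : EquilateralPolygon n d) : Prop :=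
  ∃ c u v : EuclideanSpace ℝ (Fin d), Orthonormal ℝ ![u, v] ∧ p.vertex = circleVertex n c u v

theorem dist_circleVertex {n d : ℕ} (hn : 3 ≤ n) (c u v : EuclideanSpace ℝ (Fin d))
    (huv : Orthonormal ℝ ![u, v]) (i : ZMod n) :
    dist (circleVertex n c u v i) (circleVertex n c u v (i + 1)) = 1 / (n : ℝ) := by
  have : NeZero n := ⟨by omega⟩
  have : Fact (1 < n) := ⟨by omega⟩
  have hn0 : (0 : ℝ) < n := by exact_mod_cast (by omega : 0 < n)
  have hs : 0 < Real.sin (Real.pi / n) := by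
    apply Real.sin_pos_of_pos_of_lt_pi (by positivity)
    rw [div_lt_iff₀ hn0]
    have : (3 : ℝ) ≤ n := by exact_mod_cast hn
    nlinarith [Real.pi_pos]
  have hu : ‖u‖ = 1 := by simpa using huv.1 0
  have hv : ‖v‖ = 1 := by simpa using huv.1 1
  have huv' : inner ℝ u v = 0 := by
    have := huv.2 (show (0 : Fin 2) ≠ 1 by decide)
    simpa using this
  set a : ℝ := 2 * Real.pi * (i.val : ℝ) / n with ha
  have hcs : Real.cos (2 * Real.pi * ((i + 1).val : ℝ) / n) = Real.cos (a + 2 * (Real.pi / n)) ∧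
      Real.sin (2 * Real.pi * ((i + 1).val : ℝ) / n) = Real.sin (a + 2 * (Real.pi / n)) := by
    rcases Nat.lt_or_ge (i.val + 1) n with h | h
    · have h1 : (i + 1).val = i.val + 1 := by
        rw [ZMod.val_add, ZMod.val_one, Nat.mod_eq_of_lt h]
      have h2 : 2 * Real.pi * ((i + 1).val : ℝ) / n = a + 2 * (Real.pi / n) := by
        rw [h1, ha]; push_cast; ring
      rw [h2]; exact ⟨rfl, rfl⟩
    · have h0 : i.val + 1 = n := le_antisymm (ZMod.val_lt i) h
      have h1 : (i + 1).val = 0 := by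
        rw [ZMod.val_add, ZMod.val_one, h0, Nat.mod_self]
      have h2 : a + 2 * (Real.pi / n) = 2 * Real.pi := by
        have : ((i.val : ℝ) + 1) = n := by exact_mod_cast h0
        rw [ha, ← this]
        have h3 : ((i.val : ℝ) + 1) ≠ 0 := by positivity
        field_simp
      rw [h2, h1]; simp
  unfold circleVertex
  rw [hcs.1, hcs.2, dist_add_left, dist_smul₀, dist_eq_norm]
  have key : ‖(Real.cos a • u + Real.sin a • v) - (Real.cos (a + 2 * (Real.pi / n)) • u +
      Real.sin (a + 2 * (Real.pi / n)) • v)‖ = 2 * Real.sin (Real.pi / n) := by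
    have e : (Real.cos a • u + Real.sin a • v) - (Real.cos (a + 2 * (Real.pi / n)) • u +
        Real.sin (a + 2 * (Real.pi / n)) • v) =
        (Real.cos a - Real.cos (a + 2 * (Real.pi / n))) • u +
        (Real.sin a - Real.sin (a + 2 * (Real.pi / n))) • v := by module
    rw [e, ← sq_eq_sq₀ (norm_nonneg _) (by positivity), norm_add_sq_real, norm_smul, norm_smul,
      hu, hv, inner_smul_left, inner_smul_right, huv']
    simp only [mul_one, mul_zero, add_zero, Real.norm_eq_abs, sq_abs]
    have hd2 : Real.cos (a + 2 * (Real.pi / n) - a) = Real.cos (2 * (Real.pi / n)) := by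
      congr 1; ring
    rw [Real.cos_sub, Real.cos_two_mul] at hd2
    linear_combination (-2) * hd2 + Real.sin_sq_add_cos_sq a +
      Real.sin_sq_add_cos_sq (a + 2 * (Real.pi / n)) - 4 * Real.sin_sq_add_cos_sq (Real.pi / n)
  rw [key, Real.norm_eq_abs, abs_of_pos (by positivity)]
  field_simp

/-- The first two standard unit vectors of `ℝ^d`, `d ≥ 2`, are orthonormal. -/
theorem orthonormal_single_pair {d : ℕ} (hd : 2 ≤ d) :
    Orthonormal ℝ ![EuclideanSpace.single (⟨0, by omega⟩ : Fin d) (1 : ℝ),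
      EuclideanSpace.single (⟨1, by omega⟩ : Fin d) (1 : ℝ)] := by
  rw [orthonormal_iff_ite]
  intro i j
  fin_cases i <;> fin_cases j <;> simp [EuclideanSpace.inner_single_left]

/-- The regular `n`-gon `g_n` of length `1` around the origin in the plane of the first two
coordinates of `ℝ^d`. -/
def regularNgon (n d : ℕ) (hn : 3 ≤ n) (hd : 2 ≤ d) : EquilateralPolygon n d where
  vertex := circleVertex n 0 (EuclideanSpace.single (⟨0, by omega⟩ : Fin d) (1 : ℝ))
    (EuclideanSpace.single (⟨1, by omega⟩ : Fin d) (1 : ℝ))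
  dist_vertex := dist_circleVertex hn _ _ _ (orthonormal_single_pair hd)

end

/-! Lower bound and rigidity use only the curvature. If `thickness⁻¹` is at most `2 n tan (π / n)`,
every exterior angle is at most `2π/n`. The unit edge directions `T i` of a closed polygon sum to
zero, and the triangle inequality for angles, used both ways around the polygon, gives `⟪T i, T (i +
k)⟫ ≥ cos (2πk/n)`. Summed over `k`, both sides vanish, so equality holds throughout. This Gram
matrix forces the `T i` to be equally spaced on a great circle, so the polygon is regular
(`inner_eq_cos_of_sum_eq_zero`, `exists_frame_of_inner_eq_cos`).

For a regular polygon `minRad` is the inradius `r = 1 / (2 n tan (π / n))`, so it remains to see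
that doubly critical pairs are at distance at least `2r`. At a critical point `y` the chord `w = y -
x` is a positive multiple of a convex combination `N` of the outward normals of the edges at `y`.
Since `⟪y - c, N⟫ = r` and `‖N‖ ≤ 1`, the component of `y - c` along `w` is at least `r`
(`inradius_mul_norm_le_inner`). The same bound at `x` adds up to `‖w‖ ≥ 2r`. -/

namespace EquilateralPolygon

/-! ### One-sided derivatives of the distance along a polygon -/

open Filter Topology

/-- Minimality gives `A + B t ≥ 0` for small `t > 0`; let `t → 0`. The choices `σ = ±1` give the two
one-sided conditions. -/
theorem nonneg_coeff_of_isLocalMin {f : ℝ → ℝ} {s σ A B : ℝ} (hf : IsLocalMin f s)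
    (h : ∀ᶠ t in 𝓝[>] (0 : ℝ), f (s + σ * t) = f s + A * t + B * t ^ 2) : 0 ≤ A := by
  have h1 : Tendsto (fun t : ℝ => A + B * t) (𝓝[>] 0) (𝓝 A) := by
    have : Continuous fun t : ℝ => A + B * t := by fun_prop
    simpa using (this.tendsto 0).mono_left nhdsWithin_le_nhds
  have h2 : Tendsto (fun t : ℝ => s + σ * t) (𝓝[>] 0) (𝓝 s) := by
    have : Continuous fun t : ℝ => s + σ * t := by fun_prop
    simpa using (this.tendsto 0).mono_left nhdsWithin_le_nhds
  refine ge_of_tendsto h1 ?_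
  filter_upwards [h, h2.eventually hf, self_mem_nhdsWithin] with t h3 h4 (h5 : 0 < t)
  rw [h3] at h4
  by_contra hc
  push Not at hc
  nlinarith [mul_pos_of_neg_of_neg hc (neg_neg_of_pos h5)]

variable {n d : ℕ}

theorem curve_eq (p : EquilateralPolygon n d) (hn : 0 < n) (k : ℤ) {a : ℝ} (h0 : 0 ≤ a)
    (h1 : a ≤ 1) : p.curve (((k : ℝ) + a) / n) =
      p.vertex k + a • (p.vertex (k + 1) - p.vertex k) := by
  have hn' : (n : ℝ) ≠ 0 := by positivity
  have e : (n : ℝ) * (((k : ℝ) + a) / n) = k + a := by field_simp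
  unfold curve
  rw [e]
  rcases h1.lt_or_eq with h | rfl
  · have hf : ⌊(k : ℝ) + a⌋ = k := by
      rw [Int.floor_intCast_add, Int.floor_eq_zero_iff.2 ⟨h0, h⟩, add_zero]
    rw [hf, Int.fract_intCast_add, Int.fract_eq_self.2 ⟨h0, h⟩]
  -- At `a = 1` the floor jumps to the next edge, whose initial point is the same vertex.
  · have e2 : (k : ℝ) + 1 = ((k + 1 : ℤ) : ℝ) := by push_cast; rfl
    rw [e2, Int.floor_intCast, Int.fract_intCast]
    simp

/-- Just before and just after the parameter `s`, the curve runs along straight edges. -/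
theorem exists_edges_at (p : EquilateralPolygon n d) (hn : 0 < n) (s : ℝ) :
    ∃ i j : ℤ, (i = j ∨ j = i + 1) ∧
      (∃ a : ℝ, p.curve s = p.vertex i + a • (p.vertex (i + 1) - p.vertex i)) ∧
      (∃ b : ℝ, p.curve s = p.vertex j + b • (p.vertex (j + 1) - p.vertex j)) ∧
      (∀ᶠ h in 𝓝[>] (0 : ℝ), p.curve (s + (-1) * h) =
        p.curve s + (-(n * h)) • (p.vertex (i + 1) - p.vertex i)) ∧
      (∀ᶠ h in 𝓝[>] (0 : ℝ), p.curve (s + 1 * h) =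
        p.curve s + (n * h) • (p.vertex (j + 1) - p.vertex j)) := by
  have hn' : (0 : ℝ) < n := by exact_mod_cast hn
  have key : ∀ (k : ℤ) (a b : ℝ), 0 ≤ a → a ≤ 1 → 0 ≤ b → b ≤ 1 → p.curve ((k + a) / n) =
      p.curve ((k + b) / n) + (a - b) • (p.vertex (k + 1) - p.vertex k) := by
    intro k a b ha ha' hb hb'
    rw [curve_eq p hn k ha ha', curve_eq p hn k hb hb']
    module
  have small : ∀ δ : ℝ, 0 < δ → ∀ᶠ h in 𝓝[>] (0 : ℝ), 0 < h ∧ n * h < δ := by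
    intro δ hδ
    filter_upwards [Ioo_mem_nhdsGT (show 0 < δ / n by positivity)] with h hh
    exact ⟨hh.1, by have := hh.2; rwa [lt_div_iff₀ hn', mul_comm] at this⟩
  set k := ⌊(n : ℝ) * s⌋ with hk
  set a := Int.fract ((n : ℝ) * s) with ha
  have ha0 : 0 ≤ a := Int.fract_nonneg _
  have ha1 : a < 1 := Int.fract_lt_one _
  have hs : s = (k + a) / n := by
    rw [ha, hk, Int.floor_add_fract]; field_simp
  have right : ∀ᶠ h in 𝓝[>] (0 : ℝ), p.curve (s + 1 * h) =
      p.curve s + (n * h) • (p.vertex (k + 1) - p.vertex k) := by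
    filter_upwards [small (1 - a) (by linarith)] with h hh
    have : s + 1 * h = (k + (a + n * h)) / n := by rw [hs]; field_simp; ring
    have hp : 0 < n * h := mul_pos hn' hh.1
    rw [this, key k (a + n * h) a (by linarith) (by linarith) ha0 ha1.le, ← hs]
    congr 2; ring
  rcases ha0.eq_or_lt with h0 | h0
  -- At a vertex the curve arrives along edge `k - 1`, at its end parameter `1`, and leaves along
  -- edge `k`.
  · refine ⟨k - 1, k, Or.inr (by ring), ⟨1, ?_⟩, ⟨a, ?_⟩, ?_, right⟩
    · rw [hs, curve_eq p hn k ha0 ha1.le, ← h0]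
      simp
    · rw [← curve_eq p hn k ha0 ha1.le, ← hs]
    · filter_upwards [small 1 one_pos] with h hh
      have hp : 0 < n * h := mul_pos hn' hh.1
      have e1 : s + (-1) * h = (((k - 1 : ℤ) : ℝ) + (1 - n * h)) / n := by
        rw [hs, ← h0]; push_cast; field_simp; ring
      have e2 : s = (((k - 1 : ℤ) : ℝ) + 1) / n := by rw [hs, ← h0]; push_cast; ring
      rw [e1, key (k - 1) (1 - n * h) 1 (by linarith [hh.2]) (by linarith) zero_le_one le_rfl,
        ← e2]
      congr 2; ring
  · refine ⟨k, k, Or.inl rfl, ⟨a, ?_⟩, ⟨a, ?_⟩, ?_, right⟩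
    · rw [← curve_eq p hn k ha0 ha1.le, ← hs]
    · rw [← curve_eq p hn k ha0 ha1.le, ← hs]
    · filter_upwards [small a h0] with h hh
      have : s + (-1) * h = (k + (a - n * h)) / n := by rw [hs]; field_simp; ring
      have hp : 0 < n * h := mul_pos hn' hh.1
      rw [this, key k (a - n * h) a (by linarith [hh.2]) (by linarith) ha0 ha1.le, ← hs]
      congr 2; ring

/-- At a parameter that extremizes the distance to `x`, the one-sided derivatives of the
squared distance have opposite signs. -/
theorem exists_edges_of_isLocalExtr (p : EquilateralPolygon n d) (hn : 0 < n)
    {x : EuclideanSpace ℝ (Fin d)} {s : ℝ}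
    (hs : IsLocalExtr (fun u => ‖x - p.curve u‖ ^ 2) s) :
    ∃ i j : ℤ, (i = j ∨ j = i + 1) ∧
      (∃ a : ℝ, p.curve s = p.vertex i + a • (p.vertex (i + 1) - p.vertex i)) ∧
      (∃ b : ℝ, p.curve s = p.vertex j + b • (p.vertex (j + 1) - p.vertex j)) ∧
      inner ℝ (p.curve s - x) (p.vertex (i + 1) - p.vertex i) *
        inner ℝ (p.curve s - x) (p.vertex (j + 1) - p.vertex j) ≤ 0 := by
  obtain ⟨i, j, hij, hi, hj, hl, hr⟩ := p.exists_edges_at hn s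
  have hn' : (0 : ℝ) < n := by exact_mod_cast hn
  refine ⟨i, j, hij, hi, hj, ?_⟩
  set y := p.curve s with hy
  have expand : ∀ (e : EuclideanSpace ℝ (Fin d)) (h : ℝ), ‖x - (y + h • e)‖ ^ 2 =
      ‖x - y‖ ^ 2 + 2 * h * inner ℝ (y - x) e + h ^ 2 * ‖e‖ ^ 2 := by
    intro e h
    have : x - (y + h • e) = -((y - x) + h • e) := by abel
    rw [this, norm_neg, norm_add_sq_real, inner_smul_right, norm_smul, norm_sub_rev y x,
      mul_pow, Real.norm_eq_abs, sq_abs]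
    ring
  have hl' : ∀ᶠ h in 𝓝[>] (0 : ℝ), ‖x - p.curve (s + (-1) * h)‖ ^ 2 = ‖x - p.curve s‖ ^ 2 +
      (-(2 * n * inner ℝ (y - x) (p.vertex (i + 1) - p.vertex i))) * h +
        (n ^ 2 * ‖p.vertex (i + 1) - p.vertex i‖ ^ 2) * h ^ 2 := by
    filter_upwards [hl] with h hh
    rw [hh, expand]; ring
  have hr' : ∀ᶠ h in 𝓝[>] (0 : ℝ), ‖x - p.curve (s + 1 * h)‖ ^ 2 = ‖x - p.curve s‖ ^ 2 +
      (2 * n * inner ℝ (y - x) (p.vertex (j + 1) - p.vertex j)) * h +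
        (n ^ 2 * ‖p.vertex (j + 1) - p.vertex j‖ ^ 2) * h ^ 2 := by
    filter_upwards [hr] with h hh
    rw [hh, expand]; ring
  rcases hs with hs | hs
  · have h1 := nonneg_coeff_of_isLocalMin hs hl'
    have h2 := nonneg_coeff_of_isLocalMin hs hr'
    refine mul_nonpos_of_nonpos_of_nonneg ?_ ?_
    · by_contra! hc
      linarith [mul_pos (mul_pos two_pos hn') hc]
    · by_contra! hc
      linarith [mul_neg_of_pos_of_neg (mul_pos two_pos hn') hc]
  · have h1 := nonneg_coeff_of_isLocalMin (σ := -1) hs.neg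
      (A := 2 * n * inner ℝ (y - x) (p.vertex (i + 1) - p.vertex i))
      (B := -(n ^ 2 * ‖p.vertex (i + 1) - p.vertex i‖ ^ 2))
      (hl'.mono fun h hh => by rw [hh]; ring)
    have h2 := nonneg_coeff_of_isLocalMin (σ := 1) hs.neg
      (A := -(2 * n * inner ℝ (y - x) (p.vertex (j + 1) - p.vertex j)))
      (B := -(n ^ 2 * ‖p.vertex (j + 1) - p.vertex j‖ ^ 2))
      (hr'.mono fun h hh => by rw [hh]; ring)
    refine mul_nonpos_of_nonneg_of_nonpos ?_ ?_
    · by_contra! hc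
      linarith [mul_neg_of_pos_of_neg (mul_pos two_pos hn') hc]
    · by_contra! hc
      linarith [mul_pos (mul_pos two_pos hn') hc]

end EquilateralPolygon

/-! ### Trigonometric and planar tools -/

open Real in
-- Modulo `2π`, a multiple `mπ/n` closer to `0` than `π/n` must be `0`, which makes `m` a multiple
-- of `2n`, hence even.
theorem cos_odd_mul_pi_div_le {n : ℕ} (hn : 0 < n) {m : ℤ} (hm : Odd m) :
    cos (m * π / n) ≤ cos (π / n) := by
  have hn' : (0 : ℝ) < n := by exact_mod_cast hn
  by_contra! hc
  set q : ℤ := round ((m : ℝ) / (2 * n)) with hq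
  have h1 : |(m : ℝ) / (2 * n) - q| ≤ 1 / 2 := abs_sub_round _
  have e : (m : ℝ) * π / n - q * (2 * π) = 2 * π * ((m : ℝ) / (2 * n) - q) := by field_simp
  have h2 : cos (m * π / n) = cos |(m : ℝ) * π / n - q * (2 * π)| := by
    rw [cos_abs, cos_sub_int_mul_two_pi]
  have h3 : |(m : ℝ) * π / n - q * (2 * π)| ≤ π := by
    rw [e, abs_mul, abs_of_pos two_pi_pos]
    nlinarith [pi_pos]
  rw [h2] at hc
  have h4 : |(m : ℝ) * π / n - q * (2 * π)| < π / n := by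
    by_contra! hle
    exact absurd (cos_le_cos_of_nonneg_of_le_pi (by positivity) h3 hle) (not_le.2 hc)
  have e2 : (m : ℝ) * π / n - q * (2 * π) = π / n * ((m - 2 * n * q : ℤ) : ℝ) := by
    push_cast; field_simp
  rw [e2, abs_mul, abs_of_pos (by positivity), ← Int.cast_abs] at h4
  have hp : 0 < π / n := by positivity
  have h5 : ((|m - 2 * n * q| : ℤ) : ℝ) < 1 := by
    by_contra! hle
    nlinarith
  have h6 : |m - 2 * n * q| < 1 := by exact_mod_cast h5
  have h7 : m - 2 * n * q = 0 := Int.abs_lt_one_iff.1 h6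
  obtain ⟨l, rfl⟩ := hm
  have : 2 * l + 1 = 2 * (n * q) := by linarith
  omega

theorem exists_convex_combination_eq_zero {p q : ℝ} (h : p * q ≤ 0) :
    ∃ a b : ℝ, 0 ≤ a ∧ 0 ≤ b ∧ a + b = 1 ∧ a * p + b * q = 0 := by
  by_cases h0 : p = q
  · subst h0
    have : p = 0 := by nlinarith [mul_self_nonneg p]
    exact ⟨1, 0, by simp [this]⟩
  have h1 : q - p ≠ 0 := sub_ne_zero.2 (Ne.symm h0)
  have h2 : 0 < (q - p) ^ 2 := by positivity
  -- The weights are `q / (q - p)` and `-p / (q - p)`, expanded by `q - p` so that `p * q ≤ 0` gives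
  -- their signs without cases.
  refine ⟨q * (q - p) / (q - p) ^ 2, -p * (q - p) / (q - p) ^ 2,
    div_nonneg (by nlinarith [mul_self_nonneg q]) h2.le,
    div_nonneg (by nlinarith [mul_self_nonneg p]) h2.le, ?_, ?_⟩ <;> field_simp <;> ring

section Frame

variable {V : Type*} [NormedAddCommGroup V] [InnerProductSpace ℝ V]

/-- The vector at angle `θ` in the frame `u, v`. -/
noncomputable def frameDir (u v : V) (θ : ℝ) : V := Real.cos θ • u + Real.sin θ • v

theorem inner_combination_combination {u v : V} (huv : Orthonormal ℝ ![u, v]) (a b a' b' : ℝ) :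
    inner ℝ (a • u + b • v) (a' • u + b' • v) = a * a' + b * b' := by
  have hu : ‖u‖ = 1 := by simpa using huv.1 0
  have hv : ‖v‖ = 1 := by simpa using huv.1 1
  have h : inner ℝ u v = 0 := by simpa using huv.2 (show (0 : Fin 2) ≠ 1 by decide)
  have h' : inner ℝ v u = 0 := by rw [real_inner_comm, h]
  simp only [inner_add_left, inner_add_right, real_inner_smul_left, real_inner_smul_right, h, h',
    real_inner_self_eq_norm_sq, hu, hv]
  ring

theorem inner_frameDir_frameDir {u v : V} (huv : Orthonormal ℝ ![u, v]) (α β : ℝ) :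
    inner ℝ (frameDir u v α) (frameDir u v β) = Real.cos (α - β) := by
  rw [frameDir, frameDir, inner_combination_combination huv, Real.cos_sub]

theorem norm_frameDir {u v : V} (huv : Orthonormal ℝ ![u, v]) (α : ℝ) :
    ‖frameDir u v α‖ = 1 := by
  have h := inner_frameDir_frameDir huv α α
  rw [sub_self, Real.cos_zero, real_inner_self_eq_norm_sq] at h
  nlinarith [norm_nonneg (frameDir u v α)]

/-- In the plane of `u` and `v`, a vector orthogonal to a combination of tangent directions is
parallel to the same combination of normal directions. -/
theorem norm_sq_smul_eq_inner_smul {u v : V} (huv : Orthonormal ℝ ![u, v])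
    {w₁ w₂ a b β β' : ℝ}
    (h : a * inner ℝ (w₁ • u + w₂ • v) (frameDir u v (β + Real.pi / 2)) +
      b * inner ℝ (w₁ • u + w₂ • v) (frameDir u v (β' + Real.pi / 2)) = 0) :
    ‖w₁ • u + w₂ • v‖ ^ 2 • (a • frameDir u v β + b • frameDir u v β') =
      inner ℝ (w₁ • u + w₂ • v) (a • frameDir u v β + b • frameDir u v β') •
        (w₁ • u + w₂ • v) := by
  rw [frameDir, frameDir, inner_combination_combination huv, inner_combination_combination huv,
    Real.cos_add_pi_div_two, Real.cos_add_pi_div_two, Real.sin_add_pi_div_two,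
    Real.sin_add_pi_div_two] at h
  set C := a * Real.cos β + b * Real.cos β' with hC
  set S := a * Real.sin β + b * Real.sin β' with hS
  have hN : a • frameDir u v β + b • frameDir u v β' = C • u + S • v := by
    rw [frameDir, frameDir, hC, hS]; module
  -- Orthogonality to the rotated combination is the vanishing of the planar cross product with `(C,
  -- S)`.
  have h' : w₂ * C = w₁ * S := by rw [hC, hS]; linarith
  rw [hN, ← real_inner_self_eq_norm_sq, inner_combination_combination huv,
    inner_combination_combination huv, smul_add, smul_add, smul_smul, smul_smul, smul_smul,
    smul_smul]
  congr 2
  · linear_combination w₂ * h'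
  · linear_combination (-w₁) * h'

end Frame

open Real

theorem sin_pi_div_pos {n : ℕ} (hn : 3 ≤ n) : 0 < sin (π / n) := by
  have h3 : (3 : ℝ) ≤ n := by exact_mod_cast hn
  refine sin_pos_of_pos_of_lt_pi (by positivity) ?_
  rw [div_lt_iff₀ (by linarith)]
  nlinarith [pi_pos]

theorem pi_div_lt_pi_div_two {n : ℕ} (hn : 3 ≤ n) : π / n < π / 2 := by
  have h3 : (3 : ℝ) ≤ n := by exact_mod_cast hn
  exact div_lt_div_of_pos_left pi_pos two_pos (by linarith)

theorem cos_pi_div_pos {n : ℕ} (hn : 3 ≤ n) : 0 < cos (π / n) :=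
  cos_pos_of_mem_Ioo ⟨by linarith [pi_pos, show 0 ≤ π / n by positivity], pi_div_lt_pi_div_two hn⟩

theorem tan_pi_div_pos {n : ℕ} (hn : 3 ≤ n) : 0 < tan (π / n) := by
  rw [tan_eq_sin_div_cos]
  exact div_pos (sin_pi_div_pos hn) (cos_pi_div_pos hn)

/-! ### Edges and outward normals of the regular polygon -/

section

variable {n d : ℕ} {c u v : EuclideanSpace ℝ (Fin d)}

theorem circleVertex_intCast (hn : 0 < n) (k : ℤ) : circleVertex n c u v (k : ZMod n) =
    c + (1 / (2 * (n : ℝ) * sin (π / n))) • frameDir u v (2 * π * k / n) := by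
  have : NeZero n := ⟨hn.ne'⟩
  have hn' : (n : ℝ) ≠ 0 := by positivity
  have h1 : (((k : ZMod n).val : ℤ) : ℝ) = ((k - n * (k / n) : ℤ) : ℝ) := by
    rw [ZMod.val_intCast, Int.emod_def]
  have h2 : 2 * π * ((k : ZMod n).val : ℝ) / n = 2 * π * k / n - ((k / n : ℤ) : ℝ) * (2 * π) := by
    rw [Int.cast_natCast] at h1
    rw [h1]; push_cast; field_simp
  rw [circleVertex, h2, cos_sub_int_mul_two_pi, sin_sub_int_mul_two_pi, frameDir]

/-- The angle `(2k+1)π/n` points to the midpoint of edge `k`, so it is the outward normal; the edge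
itself is a quarter turn further. -/
theorem circleVertex_succ_sub (hn : 3 ≤ n) (k : ℤ) :
    circleVertex n c u v ((k : ZMod n) + 1) - circleVertex n c u v (k : ZMod n) =
      (1 / (n : ℝ)) • frameDir u v ((2 * k + 1) * π / n + π / 2) := by
  have hn' : (n : ℝ) ≠ 0 := by positivity
  have hs := (sin_pi_div_pos hn).ne'
  have e1 : (k : ZMod n) + 1 = ((k + 1 : ℤ) : ZMod n) := by push_cast; rfl
  have e2 : 2 * π * ((k + 1 : ℤ) : ℝ) / n = (2 * k + 1) * π / n + π / n := by
    push_cast; field_simp; ring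
  have e3 : 2 * π * (k : ℝ) / n = (2 * k + 1) * π / n - π / n := by
    field_simp; ring
  rw [e1, circleVertex_intCast (by omega), circleVertex_intCast (by omega), e2, e3]
  set m := (2 * k + 1) * π / n
  simp only [frameDir, cos_add, cos_sub, sin_add, sin_sub, cos_pi_div_two, sin_pi_div_two]
  match_scalars <;> field_simp <;> ring

theorem circleVertex_injective (hn : 3 ≤ n) (huv : Orthonormal ℝ ![u, v]) :
    Function.Injective (circleVertex n c u v) := by
  have : NeZero n := ⟨by omega⟩
  have hn' : (0 : ℝ) < n := by positivity
  have hs := sin_pi_div_pos hn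
  intro i j hij
  obtain ⟨k, rfl⟩ := ZMod.intCast_surjective i
  obtain ⟨l, rfl⟩ := ZMod.intCast_surjective j
  rw [circleVertex_intCast (by omega), circleVertex_intCast (by omega), add_right_inj] at hij
  have hij' := smul_right_injective _ (by positivity) hij
  have h1 := inner_frameDir_frameDir huv (2 * π * k / n) (2 * π * l / n)
  rw [hij', inner_frameDir_frameDir huv, sub_self, cos_zero, eq_comm, cos_eq_one_iff] at h1
  obtain ⟨q, hq⟩ := h1
  have h2 : (q : ℝ) * n = k - l := by
    field_simp at hq
    linarith
  have h3 : q * n = k - l := by exact_mod_cast h2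
  rw [ZMod.intCast_eq_intCast_iff_dvd_sub]
  exact ⟨-q, by linarith⟩

/-- The polygon lies inside each edge line: vertex and normal directions differ by an odd multiple
of `π/n`. -/
theorem inner_circleVertex_sub_frameDir_le (hn : 3 ≤ n) (huv : Orthonormal ℝ ![u, v]) (k m : ℤ) :
    inner ℝ (circleVertex n c u v (k : ZMod n) - c) (frameDir u v ((2 * m + 1) * π / n)) ≤
      1 / (2 * n * tan (π / n)) := by
  have hn' : (0 : ℝ) < n := by positivity
  have hs := sin_pi_div_pos hn
  have hc := cos_pi_div_pos hn
  have e : 2 * π * k / n - (2 * m + 1) * π / n = ((2 * (k - m) - 1 : ℤ) : ℝ) * π / n := by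
    push_cast; field_simp; ring
  rw [circleVertex_intCast (by omega), add_sub_cancel_left, real_inner_smul_left,
    inner_frameDir_frameDir huv, e, tan_eq_sin_div_cos]
  have h := cos_odd_mul_pi_div_le (n := n) (by omega) (m := 2 * (k - m) - 1)
    (⟨k - m - 1, by ring⟩)
  calc _ ≤ 1 / (2 * n * sin (π / n)) * cos (π / n) := by gcongr
    _ = _ := by field_simp

theorem inner_circleVertex_sub_frameDir (hn : 3 ≤ n) (huv : Orthonormal ℝ ![u, v]) (k : ℤ)
    (a : ℝ) :
    inner ℝ (circleVertex n c u v (k : ZMod n) + a • (circleVertex n c u v ((k : ZMod n) + 1) -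
      circleVertex n c u v (k : ZMod n)) - c) (frameDir u v ((2 * k + 1) * π / n)) =
      1 / (2 * n * tan (π / n)) := by
  have hn' : (0 : ℝ) < n := by positivity
  have hs := sin_pi_div_pos hn
  have hc := cos_pi_div_pos hn
  have e : 2 * π * k / n - (2 * k + 1) * π / n = -(π / n) := by
    field_simp; ring
  rw [circleVertex_succ_sub hn, circleVertex_intCast (by omega), add_sub_right_comm,
    add_sub_cancel_left, inner_add_left, real_inner_smul_left, real_inner_smul_left,
    real_inner_smul_left, inner_frameDir_frameDir huv, inner_frameDir_frameDir huv, e, cos_neg,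
    add_sub_cancel_left, cos_pi_div_two, tan_eq_sin_div_cos]
  field_simp
  ring

theorem frameDir_combination_ne_zero (hn : 3 ≤ n) (huv : Orthonormal ℝ ![u, v]) {i j : ℤ}
    (hij : i = j ∨ j = i + 1) {a b : ℝ} (ha : 0 ≤ a) (hb : 0 ≤ b) (hab : a + b = 1) :
    a • frameDir u v ((2 * i + 1) * π / n) + b • frameDir u v ((2 * j + 1) * π / n) ≠ 0 := by
  have hn' : (0 : ℝ) < n := by positivity
  intro h0
  have h1 := congrArg (fun z => inner ℝ z z) h0
  simp only [inner_add_left, inner_add_right, real_inner_smul_left, real_inner_smul_right,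
    inner_frameDir_frameDir huv, inner_zero_left, sub_self, cos_zero] at h1
  rw [← cos_neg ((2 * (i : ℝ) + 1) * π / n - _), neg_sub] at h1
  have hc : -1 < cos ((2 * j + 1) * π / n - (2 * i + 1) * π / n) := by
    rcases hij with rfl | rfl
    · simp
    · have e : (2 * ((i + 1 : ℤ) : ℝ) + 1) * π / n - (2 * i + 1) * π / n = 2 * (π / n) := by
        push_cast; field_simp; ring
      rw [e, cos_two_mul]
      have := pow_pos (cos_pi_div_pos hn) 2
      linarith
  set q := cos ((2 * j + 1) * π / n - (2 * i + 1) * π / n)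
  -- The squared norm is `(a - b)² + 2ab(1 + q)`, a sum of nonnegative terms, and `q > -1` because
  -- adjacent normals are not opposite.
  have h2 : 0 ≤ a * b * (q + 1) := mul_nonneg (mul_nonneg ha hb) (by linarith)
  have h3 : (a - b) ^ 2 = 0 := by nlinarith [sq_nonneg (a - b)]
  obtain rfl : a = b := sub_eq_zero.1 (pow_eq_zero_iff two_ne_zero |>.1 h3)
  obtain rfl : a = 1 / 2 := by linarith
  linarith

end

/-! ### Thickness of the regular polygon -/

namespace EquilateralPolygon

variable {n d : ℕ} {c u v : EuclideanSpace ℝ (Fin d)} {p : EquilateralPolygon n d}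

theorem exists_curve_eq (p : EquilateralPolygon n d) (t : ℝ) :
    ∃ (k : ℤ) (a : ℝ), 0 ≤ a ∧ a ≤ 1 ∧
      p.curve t = p.vertex k + a • (p.vertex (k + 1) - p.vertex k) :=
  ⟨⌊(n : ℝ) * t⌋, Int.fract ((n : ℝ) * t), Int.fract_nonneg _, (Int.fract_lt_one _).le, rfl⟩

theorem inner_curve_sub_frameDir_le (hn : 3 ≤ n) (huv : Orthonormal ℝ ![u, v])
    (hp : p.vertex = circleVertex n c u v) (t : ℝ) (m : ℤ) :
    inner ℝ (p.curve t - c) (frameDir u v ((2 * m + 1) * π / n)) ≤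
      1 / (2 * n * tan (π / n)) := by
  obtain ⟨k, a, h0, h1, h⟩ := p.exists_curve_eq t
  have e : p.vertex k + a • (p.vertex (k + 1) - p.vertex k) - c =
      (1 - a) • (p.vertex k - c) + a • (p.vertex ((k + 1 : ℤ) : ZMod n) - c) := by
    push_cast; module
  rw [h, e, hp, inner_add_left, real_inner_smul_left, real_inner_smul_left]
  have h2 := inner_circleVertex_sub_frameDir_le (c := c) hn huv k m
  have h3 := inner_circleVertex_sub_frameDir_le (c := c) hn huv (k + 1) m
  nlinarith [mul_le_mul_of_nonneg_left h2 (sub_nonneg.2 h1), mul_le_mul_of_nonneg_left h3 h0]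

/-- Chords stay in the plane of the polygon, so the planar cross product argument applies in any
ambient dimension. -/
theorem exists_curve_sub_curve_eq (hn : 3 ≤ n) (hp : p.vertex = circleVertex n c u v) (t s : ℝ) :
    ∃ w₁ w₂ : ℝ, p.curve s - p.curve t = w₁ • u + w₂ • v := by
  have key : ∀ t : ℝ, ∃ w₁ w₂ : ℝ, p.curve t - c = w₁ • u + w₂ • v := by
    intro t
    obtain ⟨k, a, -, -, h⟩ := p.exists_curve_eq t
    rw [h, hp, circleVertex_succ_sub hn, circleVertex_intCast (by omega)]
    simp only [frameDir]
    set R := 1 / (2 * (n : ℝ) * sin (π / n))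
    set θ := 2 * π * (k : ℝ) / n
    set φ := (2 * (k : ℝ) + 1) * π / n + π / 2
    exact ⟨R * cos θ + a * (1 / n) * cos φ, R * sin θ + a * (1 / n) * sin φ, by module⟩
  obtain ⟨a, b, h⟩ := key s
  obtain ⟨a', b', h'⟩ := key t
  refine ⟨a - a', b - b', ?_⟩
  rw [← sub_sub_sub_cancel_right _ _ c, h, h']
  module

/-- A point of a regular polygon that is critical for the distance from another point `x` of the
polygon lies beyond the incircle in the direction away from `x`. -/
theorem inradius_mul_norm_le_inner (hn : 3 ≤ n) (huv : Orthonormal ℝ ![u, v])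
    (hp : p.vertex = circleVertex n c u v) {t s : ℝ} (hts : p.curve t ≠ p.curve s)
    (hs : IsLocalExtr (fun r => ‖p.curve t - p.curve r‖ ^ 2) s) :
    1 / (2 * n * tan (π / n)) * ‖p.curve s - p.curve t‖ ≤
      inner ℝ (p.curve s - c) (p.curve s - p.curve t) := by
  have hn' : (0 : ℝ) < n := by positivity
  have htan := tan_pi_div_pos hn
  obtain ⟨i, j, hij, ⟨α, hi⟩, ⟨β, hj⟩, hprod⟩ := p.exists_edges_of_isLocalExtr (by omega) hs
  -- These weights make the chord orthogonal to a convex combination of the adjacent edges, hence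
  -- parallel to the same combination `N` of normals.
  obtain ⟨a, b, ha, hb, hab, h⟩ := exists_convex_combination_eq_zero hprod
  rw [hp] at hi hj h
  rw [circleVertex_succ_sub hn, circleVertex_succ_sub hn, real_inner_smul_right,
    real_inner_smul_right] at h
  obtain ⟨w₁, w₂, hw⟩ := exists_curve_sub_curve_eq hn hp t s
  have hpar := norm_sq_smul_eq_inner_smul huv (w₁ := w₁) (w₂ := w₂) (a := a) (b := b)
    (β := (2 * i + 1) * π / n) (β' := (2 * j + 1) * π / n) (by
      rw [← hw]
      exact (mul_eq_zero.1 (by linarith only [h] : 1 / (n : ℝ) * _ = 0)).resolve_left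
        (by positivity))
  rw [← hw] at hpar
  have hN0 := frameDir_combination_ne_zero hn huv hij ha hb hab
  set r := 1 / (2 * n * tan (π / n)) with hr
  have hr0 : 0 < r := by positivity
  have hνi : inner ℝ (p.curve s - c) (frameDir u v ((2 * i + 1) * π / n)) = r := by
    rw [hi]; exact inner_circleVertex_sub_frameDir hn huv i α
  have hνj : inner ℝ (p.curve s - c) (frameDir u v ((2 * j + 1) * π / n)) = r := by
    rw [hj]; exact inner_circleVertex_sub_frameDir hn huv j β
  have hle : ∀ m : ℤ, inner ℝ (p.curve t - c) (frameDir u v ((2 * m + 1) * π / n)) ≤ r :=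
    inner_curve_sub_frameDir_le hn huv hp t
  have hN1 : ‖a • frameDir u v ((2 * i + 1) * π / n) +
      b • frameDir u v ((2 * j + 1) * π / n)‖ ≤ 1 := by
    refine (norm_add_le _ _).trans ?_
    rw [norm_smul, norm_smul, norm_frameDir huv, norm_frameDir huv, norm_of_nonneg ha,
      norm_of_nonneg hb]
    linarith
  have hsN : inner ℝ (p.curve s - c) (a • frameDir u v ((2 * i + 1) * π / n) +
      b • frameDir u v ((2 * j + 1) * π / n)) = r := by
    rw [inner_add_right, real_inner_smul_right, real_inner_smul_right, hνi, hνj, ← add_mul, hab,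
      one_mul]
  have htN : inner ℝ (p.curve t - c) (a • frameDir u v ((2 * i + 1) * π / n) +
      b • frameDir u v ((2 * j + 1) * π / n)) ≤ r := by
    rw [inner_add_right, real_inner_smul_right, real_inner_smul_right]
    nlinarith [mul_le_mul_of_nonneg_left (hle i) ha, mul_le_mul_of_nonneg_left (hle j) hb]
  set N := a • frameDir u v ((2 * i + 1) * π / n) + b • frameDir u v ((2 * j + 1) * π / n)
  set w := p.curve s - p.curve t with hwdef
  have hw0 : 0 < ‖w‖ := norm_pos_iff.2 (sub_ne_zero.2 hts.symm)
  have hm0 : 0 ≤ inner ℝ w N := by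
    have : w = (p.curve s - c) - (p.curve t - c) := by rw [hwdef]; abel
    rw [this, inner_sub_left, hsN]
    linarith
  -- Parallel vectors with nonnegative inner product: equality in Cauchy–Schwarz.
  have hm : inner ℝ w N = ‖w‖ * ‖N‖ := by
    have h1 := congrArg norm hpar
    rw [norm_smul, norm_smul, norm_of_nonneg hm0, norm_of_nonneg (by positivity)] at h1
    have h2 : ‖w‖ * (inner ℝ w N) = ‖w‖ * (‖w‖ * ‖N‖) := by linarith
    exact mul_left_cancel₀ hw0.ne' h2
  have hN : 0 < ‖N‖ := norm_pos_iff.2 hN0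
  have h3 := congrArg (fun z => inner ℝ (p.curve s - c) z) hpar
  simp only [real_inner_smul_right, hsN, hm] at h3
  have h4 : ‖w‖ * r = ‖N‖ * inner ℝ (p.curve s - c) w :=
    mul_left_cancel₀ hw0.ne' (by linarith)
  have h5 : 0 < inner ℝ (p.curve s - c) w :=
    pos_of_mul_pos_right (h4 ▸ mul_pos hw0 hr0) hN.le
  nlinarith

theorem two_mul_inradius_le_dist (hn : 3 ≤ n) (huv : Orthonormal ℝ ![u, v])
    (hp : p.vertex = circleVertex n c u v)
    {q : EuclideanSpace ℝ (Fin d) × EuclideanSpace ℝ (Fin d)} (hq : q ∈ p.dcrit) :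
    2 * (1 / (2 * n * tan (π / n))) ≤ dist q.2 q.1 := by
  obtain ⟨hne, t, s, h1, h2, hs, ht⟩ := hq
  rw [h1, h2] at hne ⊢
  have ht' : IsLocalExtr (fun r => ‖p.curve s - p.curve r‖ ^ 2) t := by
    simpa only [norm_sub_rev] using ht
  have a1 := inradius_mul_norm_le_inner hn huv hp hne hs
  have a2 := inradius_mul_norm_le_inner hn huv hp hne.symm ht'
  have hw0 : 0 < ‖p.curve s - p.curve t‖ := norm_pos_iff.2 (sub_ne_zero.2 hne.symm)
  -- The centre cancels, so the bounds at the two ends add up to `‖w‖² ≥ 2r‖w‖`.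
  have e : ‖p.curve s - p.curve t‖ ^ 2 = inner ℝ (p.curve s - c) (p.curve s - p.curve t) +
      inner ℝ (p.curve t - c) (p.curve t - p.curve s) := by
    rw [← real_inner_self_eq_norm_sq, ← neg_sub (p.curve s) (p.curve t), inner_neg_right,
      ← sub_eq_add_neg, ← inner_sub_left, sub_sub_sub_cancel_right]
  rw [norm_sub_rev (p.curve t)] at a2
  rw [dist_eq_norm]
  nlinarith

theorem dcsd_ge (hn : 3 ≤ n) (huv : Orthonormal ℝ ![u, v])
    (hp : p.vertex = circleVertex n c u v) :
    ENNReal.ofReal (2 * (1 / (2 * n * tan (π / n)))) ≤ p.dcsd := by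
  refine le_iInf₂ fun q hq => ?_
  rw [edist_dist]
  exact ENNReal.ofReal_le_ofReal (two_mul_inradius_le_dist hn huv hp hq)

theorem norm_vertex_sub (p : EquilateralPolygon n d) (i : ZMod n) :
    ‖p.vertex (i + 1) - p.vertex i‖ = 1 / n := by
  rw [← dist_eq_norm, dist_comm, p.dist_vertex]

theorem discreteCurvature_of_angle_ne_pi (p : EquilateralPolygon n d) (i : ZMod n)
    (h : InnerProductGeometry.angle (p.vertex i - p.vertex (i - 1))
      (p.vertex (i + 1) - p.vertex i) ≠ π) :
    discreteCurvature (p.vertex (i - 1)) (p.vertex i) (p.vertex (i + 1)) =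
      ENNReal.ofReal (2 * n * tan (InnerProductGeometry.angle (p.vertex i - p.vertex (i - 1))
      (p.vertex (i + 1) - p.vertex i) / 2)) := by
  have h1 := p.norm_vertex_sub i
  have h2 := p.norm_vertex_sub (i - 1)
  rw [sub_add_cancel, norm_sub_rev] at h2
  rw [discreteCurvature, if_neg h, h1, h2]
  congr 1
  rw [add_self_div_two, div_div_eq_mul_div, div_one]
  ring

theorem angle_circleVertex (hn : 3 ≤ n) (huv : Orthonormal ℝ ![u, v]) (i : ZMod n) :
    InnerProductGeometry.angle (circleVertex n c u v i - circleVertex n c u v (i - 1))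
      (circleVertex n c u v (i + 1) - circleVertex n c u v i) = 2 * (π / n) := by
  have hn' : (0 : ℝ) < n := by positivity
  obtain ⟨k, rfl⟩ := ZMod.intCast_surjective i
  have e1 : ((k - 1 : ℤ) : ZMod n) + 1 = k := by push_cast; ring
  have e2 : ((k - 1 : ℤ) : ZMod n) = (k : ZMod n) - 1 := by push_cast; rfl
  have h1 := circleVertex_succ_sub (c := c) (u := u) (v := v) hn (k - 1)
  rw [e1, e2] at h1
  rw [h1, circleVertex_succ_sub hn, InnerProductGeometry.angle_smul_left_of_pos _ _ (by positivity),
    InnerProductGeometry.angle_smul_right_of_pos _ _ (by positivity), InnerProductGeometry.angle,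
    inner_frameDir_frameDir huv, norm_frameDir huv, norm_frameDir huv, mul_one, div_one]
  have e3 : (2 * ((k - 1 : ℤ) : ℝ) + 1) * π / n + π / 2 - ((2 * k + 1) * π / n + π / 2) =
      -(2 * (π / n)) := by push_cast; field_simp; ring
  rw [e3, cos_neg, arccos_cos (by positivity) (by linarith [pi_div_lt_pi_div_two hn])]

/-- The curvature term already equals the inradius, so a lower bound for `dcsd` suffices; its exact
value is irrelevant. -/
theorem IsRegular.thickness_inv (hn : 3 ≤ n) (hp : p.IsRegular) :
    p.thickness⁻¹ = ENNReal.ofReal (2 * n * tan (π / n)) := by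
  obtain ⟨c, u, v, huv, hp⟩ := hp
  have hn' : (0 : ℝ) < n := by positivity
  have htan := tan_pi_div_pos hn
  have : NeZero n := ⟨by omega⟩
  have hκ : ∀ i, discreteCurvature (p.vertex (i - 1)) (p.vertex i) (p.vertex (i + 1)) =
      ENNReal.ofReal (2 * n * tan (π / n)) := by
    intro i
    have ha : InnerProductGeometry.angle (p.vertex i - p.vertex (i - 1))
        (p.vertex (i + 1) - p.vertex i) = 2 * (π / n) := by
      rw [hp]; exact angle_circleVertex hn huv i
    have := pi_div_lt_pi_div_two hn
    rw [discreteCurvature_of_angle_ne_pi, ha, mul_div_cancel_left₀ _ two_ne_zero]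
    rw [ha]
    linarith
  have hmin : p.minRad = (ENNReal.ofReal (2 * n * tan (π / n)))⁻¹ := by
    simp only [minRad, hκ, ciInf_const]
  rw [thickness, if_pos (hp ▸ circleVertex_injective hn huv), hmin, min_eq_left, inv_inv]
  rw [← ENNReal.ofReal_inv_of_pos (by positivity), ENNReal.le_div_iff_mul_le (by simp) (by simp)]
  convert dcsd_ge hn huv hp using 1
  rw [mul_comm, ENNReal.ofReal_mul zero_le_two, ENNReal.ofReal_ofNat, one_div]

end EquilateralPolygon

/-! ### Rigidity of closed chains of unit vectors -/

theorem sum_cos_two_pi_mul_div {n : ℕ} (hn : 1 < n) :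
    ∑ k ∈ Finset.range n, cos (2 * π * k / n) = 0 := by
  have h := (Complex.isPrimitiveRoot_exp n (by omega)).geom_sum_eq_zero hn
  have h1 := congrArg Complex.re h
  rw [Complex.re_sum, Complex.zero_re] at h1
  rw [← h1]
  refine Finset.sum_congr rfl fun k _ => ?_
  rw [← Complex.exp_nat_mul]
  have e : (k : ℂ) * (2 * π * Complex.I / n) = ((2 * π * k / n : ℝ) : ℂ) * Complex.I := by
    push_cast; ring
  rw [e, Complex.exp_ofReal_mul_I_re]

section

variable {V : Type*} [NormedAddCommGroup V] [InnerProductSpace ℝ V]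

theorem inner_ge_cos_of_angle_le {x y : V} (hx : ‖x‖ = 1) (hy : ‖y‖ = 1) {α : ℝ} (hα : α ≤ π)
    (h : InnerProductGeometry.angle x y ≤ α) : cos α ≤ inner ℝ x y := by
  have := cos_le_cos_of_nonneg_of_le_pi (InnerProductGeometry.angle_nonneg x y) hα h
  rwa [InnerProductGeometry.cos_angle, hx, hy, mul_one, div_one] at this

theorem angle_add_natCast_le {n : ℕ} {T : ZMod n → V} (hT : ∀ i, ‖T i‖ = 1) {α : ℝ}
    (h : ∀ i, InnerProductGeometry.angle (T i) (T (i + 1)) ≤ α) (i : ZMod n) (k : ℕ) :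
    InnerProductGeometry.angle (T i) (T (i + k)) ≤ k * α := by
  induction k with
  | zero =>
    have : T i ≠ 0 := norm_ne_zero_iff.1 (by simp [hT])
    simp [InnerProductGeometry.angle_self this]
  | succ k ih =>
    have h1 := InnerProductGeometry.angle_le_angle_add_angle (T i) (T (i + k)) (T (i + k + 1))
    have h2 := h (i + k)
    push_cast
    rw [← add_assoc]
    linarith

/-- Fenchel rigidity: unit vectors with vanishing sum whose consecutive angles are at most `2π/n`
have the Gram matrix of the vertices of a regular `n`-gon. -/
theorem inner_eq_cos_of_sum_eq_zero {n : ℕ} [NeZero n] (hn : 1 < n) {T : ZMod n → V}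
    (hT : ∀ i, ‖T i‖ = 1) (hsum : ∑ i, T i = 0)
    (h : ∀ i, InnerProductGeometry.angle (T i) (T (i + 1)) ≤ 2 * π / n) (i : ZMod n) {k : ℕ}
    (hk : k < n) : inner ℝ (T i) (T (i + k)) = cos (2 * π * k / n) := by
  have hn' : (0 : ℝ) < n := by positivity
  have hge : ∀ (i : ZMod n) (k : ℕ), k ∈ Finset.range n →
      cos (2 * π * k / n) ≤ inner ℝ (T i) (T (i + k)) := by
    intro i k hk
    rw [Finset.mem_range] at hk
    rcases le_total (2 * k) n with h2 | h2
    · have h2' : 2 * (k : ℝ) ≤ n := by exact_mod_cast h2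
      have h3 := angle_add_natCast_le hT h i k
      refine inner_ge_cos_of_angle_le (hT _) (hT _) ?_ (h3.trans_eq (by ring))
      rw [div_le_iff₀ hn']
      nlinarith [pi_pos]
    -- Past half way, go on from `i + k` to `i` in `n - k` steps; this keeps the angle bound within
    -- `[0, π]`, where `cos` decreases.
    · have h2' : (n : ℝ) ≤ 2 * k := by exact_mod_cast h2
      have h3 := angle_add_natCast_le hT h (i + k) (n - k)
      have e : i + (k : ZMod n) + ((n - k : ℕ) : ZMod n) = i := by
        rw [Nat.cast_sub hk.le, ZMod.natCast_self]; ring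
      rw [e, InnerProductGeometry.angle_comm, Nat.cast_sub hk.le] at h3
      have e2 : cos (2 * π * k / n) = cos ((n - k) * (2 * π / n)) := by
        rw [← cos_two_pi_sub]
        congr 1
        field_simp
      rw [e2]
      refine inner_ge_cos_of_angle_le (hT _) (hT _) ?_ h3
      rw [← mul_div_assoc, div_le_iff₀ hn']
      nlinarith [pi_pos]
  have hzero : ∀ i : ZMod n, ∑ k ∈ Finset.range n, inner ℝ (T i) (T (i + k)) = 0 := by
    intro i
    have e : ∑ k ∈ Finset.range n, T (i + k) = 0 := by
      rw [← hsum, ← Equiv.sum_comp (Equiv.addLeft i) T]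
      refine Finset.sum_nbij' (fun k : ℕ => (k : ZMod n)) (fun j => j.val) ?_ ?_ ?_ ?_ ?_
      · simp
      · intro j _; simpa using ZMod.val_lt j
      · intro k hk; exact ZMod.val_cast_of_lt (Finset.mem_range.1 hk)
      · intro j _; exact ZMod.natCast_zmod_val j
      · intro k _; rfl
    rw [← inner_sum, e, inner_zero_right]
  -- Termwise inequality between two sums that are both zero forces termwise equality.
  have heq := (Finset.sum_eq_sum_iff_of_le (hge i)).1
    ((sum_cos_two_pi_mul_div hn).trans (hzero i).symm)
  exact (heq k (Finset.mem_range.2 hk)).symm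

/-- Unit vectors with the Gram matrix of the vertices of a regular `n`-gon are equally spaced on
a great circle. -/
theorem exists_frame_of_inner_eq_cos {n : ℕ} [NeZero n] (hn : 3 ≤ n) {T : ZMod n → V}
    (h : ∀ (i : ZMod n) (k : ℕ), k < n → inner ℝ (T i) (T (i + k)) = cos (2 * π * k / n)) :
    ∃ u v : V, Orthonormal ℝ ![u, v] ∧ ∀ i, T i = frameDir u v (2 * π * i.val / n) := by
  have hn' : (0 : ℝ) < n := by positivity
  have hT : ∀ i, inner ℝ (T i) (T i) = 1 := by
    intro i; simpa using h i 0 (by omega)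
  set α := 2 * π / n with hα
  have hsin : 0 < sin α := by
    have e : α = 2 * (π / n) := by rw [hα]; ring
    rw [e, sin_two_mul]
    have := sin_pi_div_pos hn
    have := cos_pi_div_pos hn
    positivity
  have h0 : ∀ i : ZMod n, inner ℝ (T 0) (T i) = cos (2 * π * i.val / n) := by
    intro i; simpa using h 0 i.val (ZMod.val_lt i)
  have h01 : inner ℝ (T 0) (T 1) = cos α := by
    simpa [hα] using h 0 1 (by omega)
  have h1 : ∀ i : ZMod n, inner ℝ (T 1) (T i) = cos (2 * π * i.val / n - α) := by
    intro i
    -- Index `0` is separate because `i.val - 1` would truncate.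
    rcases Nat.eq_zero_or_pos i.val with hi | hi
    · have : i = 0 := (ZMod.val_eq_zero i).1 hi
      subst this
      rw [real_inner_comm, h01]
      simp
    · have h2 := h 1 (i.val - 1) ((Nat.sub_le _ _).trans_lt (ZMod.val_lt i))
      rw [Nat.cast_sub hi, ZMod.natCast_zmod_val, Nat.cast_sub hi] at h2
      simp only [Nat.cast_one, add_sub_cancel] at h2
      rw [h2, hα]
      congr 1
      ring
  -- Gram–Schmidt on `T 0, T 1`; `sin α ≠ 0` since `n ≥ 3`.
  set v := (sin α)⁻¹ • (T 1 - cos α • T 0) with hv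
  have huv : inner ℝ (T 0) v = 0 := by
    rw [hv, real_inner_smul_right, inner_sub_right, real_inner_smul_right, hT, h01]; simp
  have hvi : ∀ i : ZMod n, inner ℝ v (T i) = sin (2 * π * i.val / n) := by
    intro i
    rw [hv, real_inner_smul_left, inner_sub_left, real_inner_smul_left, h0, h1, cos_sub]
    field_simp
    ring
  have hvv : inner ℝ v v = 1 := by
    nth_rw 2 [hv]
    rw [real_inner_smul_right, inner_sub_right, real_inner_smul_right, real_inner_comm (T 0) v,
      huv, hvi]
    have : Fact (1 < n) := ⟨by omega⟩
    rw [ZMod.val_one]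
    have e : 2 * π * ((1 : ℕ) : ℝ) / n = α := by rw [hα]; push_cast; ring
    rw [e]
    field_simp
    ring
  refine ⟨T 0, v, ?_, fun i => ?_⟩
  · rw [orthonormal_iff_ite]
    intro i j
    fin_cases i <;> fin_cases j <;> simp only [Fin.zero_eta, Fin.mk_one, Matrix.cons_val_zero,
      Matrix.cons_val_one, hT, huv, hvv, real_inner_comm (T 0) v] <;> simp
  -- The squared norm of the difference expands to `1 - cos² θ - sin² θ`.
  · rw [← sub_eq_zero, ← inner_self_eq_zero (𝕜 := ℝ), frameDir]
    set θ := 2 * π * (i.val : ℝ) / n with hθ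
    simp only [inner_sub_left, inner_sub_right, inner_add_left, inner_add_right,
      real_inner_smul_left, real_inner_smul_right, hT, hvv, huv, real_inner_comm (T 0) v, h0, hvi,
      real_inner_comm (T 0) (T i), real_inner_comm v (T i), ← hθ]
    linear_combination (-1) * sin_sq_add_cos_sq θ

end

/-! ### From curvature bounds to regularity -/

namespace EquilateralPolygon

variable {n d : ℕ} {p : EquilateralPolygon n d}

theorem isRegular_of_angle_le (hn : 3 ≤ n)
    (h : ∀ i, InnerProductGeometry.angle (p.vertex i - p.vertex (i - 1))
      (p.vertex (i + 1) - p.vertex i) ≤ 2 * π / n) : p.IsRegular := by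
  have : NeZero n := ⟨by omega⟩
  have hn' : (0 : ℝ) < n := by positivity
  set T : ZMod n → EuclideanSpace ℝ (Fin d) :=
    fun i => (n : ℝ) • (p.vertex (i + 1) - p.vertex i) with hTdef
  have hT : ∀ i, ‖T i‖ = 1 := by
    intro i
    rw [hTdef, norm_smul, p.norm_vertex_sub, norm_of_nonneg hn'.le]
    field_simp
  have hsum : ∑ i, T i = 0 := by
    have h1 : ∑ i, p.vertex (i + 1) = ∑ i, p.vertex i :=
      Equiv.sum_comp (Equiv.addRight (1 : ZMod n)) p.vertex
    rw [hTdef, ← Finset.smul_sum, Finset.sum_sub_distrib, h1, sub_self, smul_zero]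
  have hang : ∀ i, InnerProductGeometry.angle (T i) (T (i + 1)) ≤ 2 * π / n := by
    intro i
    rw [hTdef]
    simp only
    rw [InnerProductGeometry.angle_smul_left_of_pos _ _ hn',
      InnerProductGeometry.angle_smul_right_of_pos _ _ hn']
    simpa using h (i + 1)
  obtain ⟨a, b, hab, hTi⟩ := exists_frame_of_inner_eq_cos hn fun i k hk =>
    inner_eq_cos_of_sum_eq_zero (by omega) hT hsum hang i hk
  set α := π / n with hα
  -- The frame `a, b` turned by `-(α + π/2)`, which absorbs the offset between the directions of a
  -- vertex and of the edge leaving it.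
  set u := -sin α • a - cos α • b with hu
  set v := cos α • a - sin α • b with hv
  have huv : Orthonormal ℝ ![u, v] := by
    have eu : u = (-sin α) • a + (-cos α) • b := by rw [hu]; module
    have ev : v = cos α • a + (-sin α) • b := by rw [hv]; module
    have h1 := sin_sq_add_cos_sq α
    rw [orthonormal_iff_ite]
    intro i j
    fin_cases i <;> fin_cases j <;> simp only [Fin.zero_eta, Fin.mk_one, Matrix.cons_val_zero,
      Matrix.cons_val_one, eu, ev, inner_combination_combination hab] <;> simp <;> linarith
  refine ⟨p.vertex 0 - circleVertex n 0 u v 0, u, v, huv, ?_⟩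
  -- This centre makes the vertices with index `0` agree; equal edges then propagate the agreement.
  set c := p.vertex 0 - circleVertex n 0 u v 0 with hc
  have hdiff : ∀ k : ℕ, k < n → p.vertex ((k : ZMod n) + 1) - p.vertex k =
      circleVertex n c u v ((k : ZMod n) + 1) - circleVertex n c u v k := by
    intro k hk
    have h1 := circleVertex_succ_sub (c := c) (u := u) (v := v) hn k
    rw [Int.cast_natCast] at h1
    rw [h1]
    have h2 := hTi k
    rw [ZMod.val_cast_of_lt hk] at h2
    have h3 : p.vertex ((k : ZMod n) + 1) - p.vertex k = (1 / (n : ℝ)) • T k := by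
      rw [hTdef, smul_smul, one_div_mul_cancel hn'.ne', one_smul]
    rw [h3, h2]
    congr 1
    have e : (2 * ((k : ℤ) : ℝ) + 1) * π / n + π / 2 = 2 * π * k / n + α + π / 2 := by
      rw [hα]; push_cast; ring
    rw [e]
    set θ := 2 * π * (k : ℝ) / n
    have h4 := sin_sq_add_cos_sq α
    simp only [frameDir, hu, hv, cos_add, sin_add, cos_pi_div_two, sin_pi_div_two]
    match_scalars
    · linear_combination (-cos θ) * h4
    · linear_combination (-sin θ) * h4
  have key : ∀ k : ℕ, k < n → p.vertex k = circleVertex n c u v k := by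
    intro k
    induction k with
    | zero =>
      intro _
      rw [Nat.cast_zero]
      have : circleVertex n c u v 0 = c + circleVertex n 0 u v 0 := by simp [circleVertex]
      rw [this, hc, sub_add_cancel]
    | succ k ih =>
      intro hk
      have h1 := hdiff k (by omega)
      rw [ih (by omega), sub_left_inj] at h1
      rw [Nat.cast_succ, h1]
  funext i
  have := key i.val (ZMod.val_lt i)
  rwa [ZMod.natCast_zmod_val] at this

theorem isRegular_of_thickness_inv_le (hn : 3 ≤ n)
    (h : p.thickness⁻¹ ≤ ENNReal.ofReal (2 * n * tan (π / n))) : p.IsRegular := by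
  have hn' : (0 : ℝ) < n := by positivity
  have htan := tan_pi_div_pos hn
  have hκ : ∀ i, discreteCurvature (p.vertex (i - 1)) (p.vertex i) (p.vertex (i + 1)) ≤
      ENNReal.ofReal (2 * n * tan (π / n)) := by
    intro i
    refine le_trans ?_ h
    -- If vertices coincide, the thickness is `0` and the bound is trivial.
    rw [ENNReal.le_inv_iff_le_inv, thickness]
    split_ifs
    · exact (min_le_left _ _).trans (iInf_le _ i)
    · exact zero_le
  refine isRegular_of_angle_le hn fun i => ?_
  have hi := hκ i
  have hne : InnerProductGeometry.angle (p.vertex i - p.vertex (i - 1))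
      (p.vertex (i + 1) - p.vertex i) ≠ π := by
    intro hπ
    rw [discreteCurvature, if_pos hπ, top_le_iff] at hi
    exact ENNReal.ofReal_ne_top hi
  rw [p.discreteCurvature_of_angle_ne_pi i hne, ENNReal.ofReal_le_ofReal_iff (by positivity)] at hi
  set φ := InnerProductGeometry.angle (p.vertex i - p.vertex (i - 1))
      (p.vertex (i + 1) - p.vertex i) with hφ
  have hφπ : φ < π := lt_of_le_of_ne (InnerProductGeometry.angle_le_pi _ _) hne
  by_contra! hlt
  have h1 : π / n < φ / 2 := by
    have e : 2 * π / n = 2 * (π / n) := by ring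
    rw [e] at hlt
    linarith
  have h2 := tan_lt_tan_of_nonneg_of_lt_pi_div_two (by positivity) (by linarith) h1
  have h3 := mul_lt_mul_of_pos_left h2 (show 0 < 2 * (n : ℝ) by positivity)
  linarith

end EquilateralPolygon

theorem isRegular_regularNgon (n d : ℕ) (hn : 3 ≤ n) (hd : 2 ≤ d) :
    (regularNgon n d hn hd).IsRegular :=
  ⟨_, _, _, orthonormal_single_pair hd, rfl⟩

theorem proposition5 (n d : ℕ) (hn : 3 ≤ n) (hd : 2 ≤ d) :
    ((regularNgon n d hn hd).thickness)⁻¹ =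
        ENNReal.ofReal (2 * (n : ℝ) * Real.tan (Real.pi / n)) ∧
      ∀ p : EquilateralPolygon n d,
        ((regularNgon n d hn hd).thickness)⁻¹ ≤ (p.thickness)⁻¹ ∧
          (((regularNgon n d hn hd).thickness)⁻¹ = (p.thickness)⁻¹ ↔ p.IsRegular) := by
  have h := (isRegular_regularNgon n d hn hd).thickness_inv hn
  refine ⟨h, fun p => ?_⟩
  rw [h]
  refine ⟨?_, fun he => EquilateralPolygon.isRegular_of_thickness_inv_le hn he.ge,
    fun hp => (hp.thickness_inv hn).symm⟩
  -- A strictly smaller value would make `p` regular, and then the values agree.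
  by_contra! hlt
  exact hlt.ne ((EquilateralPolygon.isRegular_of_thickness_inv_le hn hlt.le).thickness_inv hn)
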